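/- Let $\omega=\frac{-1+\sqrt{-3}}{2}$, let $E_\omega=\mathbf C/(\mathbf Z+\mathbf Z\omega)$, and let $M=E_\omega\times E_\omega\times E_\omega$. For a holomorphic automorphism $f$ of $M$ and $p\ge 0$, the $p$-th dynamical degree is $$\lambda_p(f)=\lim_{n\to\infty} r_p(f^n)^{1/n},$$ where $r_p(g)$ denotes the spectral radius of $g^*$ on $H^{p,p}(M)$. A Salem number is a real algebraic integer $s>1$ such that $1/s$ is a Galois conjugate of $s$ and all Galois conjugates of $s$ other than $s$ and $1/s$ lie on the unit circle. Let $a\ge 1$ be an integer and let $f=f_a$ be the automorphism of $M$ given by the matrix $$P_a=\begin{pmatrix}0&1&0\\0&0&1\\-1&3a^2&0\end{pmatrix}\in \mathrm{GL}(3,\mathbf Z).$$ The characteristic polynomial of $P_a$ is $x^3-3a^2x+1$. It has three real roots $\alpha,\beta,\gamma$, which can be labelled so that $|\beta|<1<|\gamma|<|\alpha|$, and the limits defining $\lambda_1(f)$ and $\lambda_2(f)$ exist and satisfy $$\lambda_1(f)=\alpha^2,\qquad \lambda_2(f)=\alpha^2\gamma^2,\qquad \lambda_2(f)>\lambda_1(f)>1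 .$$ Moreover, $\lambda_1(f)$ is not a Salem number. -/

import Mathlib

open scoped ContDiff Topology ENNReal
open Filter Polynomial

noncomputable section

namespace EisensteinTorus

/-! ### The complex torus `M = E_ω × E_ω × E_ω` -/

/-- `ω = (-1 + √-3) / 2`. -/
def omega : ℂ := (-1 + (Real.sqrt 3 : ℂ) * Complex.I) / 2

/-- The lattice `ℤ + ℤ ω` in `ℂ`. -/
def lattice : AddSubgroup ℂ := AddSubgroup.closure {1, omega}

/-- The elliptic curve `E_ω = ℂ / (ℤ + ℤ ω)`. -/
abbrev E : Type := ℂ ⧸ lattice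

/-- The complex torus `E_ω × E_ω × E_ω`. -/
abbrev M : Type := Fin 3 → E

/-- The universal cover `ℂ³` of `M`; it is also the tangent space of `M` at every point, through
the differential of the covering map. -/
abbrev V : Type := Fin 3 → ℂ

/-- The covering map `ℂ³ → M`. -/
def proj (z : V) : M := fun i => (z i : E)

lemma proj_surjective : Function.Surjective proj := by
  intro x
  choose z hz using fun i => QuotientAddGroup.mk_surjective (x i)
  exact ⟨z, funext hz⟩

lemma proj_add (z w : V) : proj (z + w) = proj z + proj w := rfl

lemma proj_sub (z w : V) : proj (z - w) = proj z - proj w := rfl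

lemma one_le_norm_of_mem_lattice {z : ℂ} (hz : z ∈ lattice) (h0 : z ≠ 0) : 1 ≤ ‖z‖ := by
  obtain ⟨m, n, rfl⟩ := AddSubgroup.mem_closure_pair.1 hz
  have hs : Real.sqrt 3 * Real.sqrt 3 = 3 := Real.mul_self_sqrt (by norm_num)
  have key : Complex.normSq (m • (1 : ℂ) + n • omega) = ((m * m - m * n + n * n : ℤ) : ℝ) := by
    rw [Complex.normSq_apply]
    simp [omega]
    linear_combination (n : ℝ) * n / 4 * hs
  have hpos : 0 < Complex.normSq (m • (1 : ℂ) + n • omega) := Complex.normSq_pos.2 h0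
  rw [key] at hpos
  have h1 : (1 : ℤ) ≤ m * m - m * n + n * n := by
    have : (0 : ℤ) < m * m - m * n + n * n := by exact_mod_cast hpos
    omega
  have h2 : (1 : ℝ) ≤ Complex.normSq (m • (1 : ℂ) + n • omega) := by
    rw [key]; exact_mod_cast h1
  rw [Complex.normSq_eq_norm_sq] at h2
  nlinarith [norm_nonneg (m • (1 : ℂ) + n • omega)]

/-- The fibres of the covering map are discrete. -/
lemma eq_zero_of_proj_eq_zero {z : V} (hz : proj z = 0) (h : ‖z‖ < 1) : z = 0 := by
  funext i
  by_contra h0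
  have hi : z i ∈ lattice := (QuotientAddGroup.eq_zero_iff _).1 (congrFun hz i)
  exact absurd ((one_le_norm_of_mem_lattice hi h0).trans (norm_le_pi_norm z i)) (not_le.2 h)

/-! ### Holomorphic self-maps of `M` and their differentials -/

/-- `F` is a holomorphic lift of `g : M → M` to `ℂ³` near the point `z`. -/
def IsHolLiftAt (g : M → M) (F : V → V) (z : V) : Prop :=
  AnalyticAt ℂ F z ∧ ∀ᶠ w in 𝓝 z, proj (F w) = g (proj w)

/-- A self-map of `M` is holomorphic if it has holomorphic local lifts to `ℂ³` (the local inverses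
of the covering map are the charts of `M`). -/
def IsHolomorphic (g : M → M) : Prop := ∀ z : V, ∃ F : V → V, IsHolLiftAt g F z

open Classical in
/-- The differential of `g` at `x`, read in `T_x M = ℂ³ = T_{g x} M`: the derivative of any
holomorphic local lift of `g` at any point over `x` (see `differential_eq`). -/
def differential (g : M → M) (x : M) : V →L[ℂ] V :=
  if h : ∃ q : V × (V → V), proj q.1 = x ∧ IsHolLiftAt g q.2 q.1 then
    fderiv ℂ h.choose.2 h.choose.1
  else 0

lemma fderiv_eq_of_lifts {g : M → M} {F F' : V → V} {z z' : V} (hz : proj z = proj z')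
    (h : IsHolLiftAt g F z) (h' : IsHolLiftAt g F' z') : fderiv ℂ F z = fderiv ℂ F' z' := by
  set l : V := z' - z with hl
  have hpl : proj l = 0 := by rw [hl, proj_sub, hz, sub_self]
  have hzl : z + l = z' := by rw [hl]; abel
  have ht : Tendsto (fun w : V => w + l) (𝓝 z) (𝓝 z') := by
    rw [← hzl]; exact (continuous_id.add continuous_const).tendsto z
  have hcF : Tendsto F (𝓝 z) (𝓝 (F z)) := h.1.continuousAt
  have hcF' : Tendsto (fun w => F' (w + l)) (𝓝 z) (𝓝 (F' z')) :=
    (h'.1.continuousAt.tendsto).comp ht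
  have hc : Tendsto (fun w => F' (w + l) - F w - (F' z' - F z)) (𝓝 z) (𝓝 0) := by
    have := (hcF'.sub hcF).sub_const (F' z' - F z)
    simpa using this
  have hsmall : ∀ᶠ w in 𝓝 z, ‖F' (w + l) - F w - (F' z' - F z)‖ < 1 := by
    have := hc.norm
    rw [norm_zero] at this
    exact this.eventually_lt_const one_pos
  have hlift' : ∀ᶠ w in 𝓝 z, proj (F' (w + l)) = g (proj (w + l)) := ht.eventually h'.2
  have h0 := h.2.self_of_nhds
  have h0' := h'.2.self_of_nhds
  have hev : (fun w => F' (w + l)) =ᶠ[𝓝 z] fun w => F w + (F' z' - F z) := by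
    filter_upwards [hsmall, hlift', h.2] with w hw1 hw2 hw3
    have : F' (w + l) - F w - (F' z' - F z) = 0 := by
      apply eq_zero_of_proj_eq_zero _ hw1
      rw [proj_sub, proj_sub, proj_sub, hw2, hw3, h0, h0', proj_add, hpl, hz]
      simp
    rw [sub_eq_zero] at this
    rw [← this]; abel
  have e1 := hev.fderiv_eq (𝕜 := ℂ)
  rw [fderiv_comp_add_right, hzl, fderiv_add_const] at e1
  exact e1.symm

lemma differential_eq {g : M → M} {F : V → V} {z : V} (h : IsHolLiftAt g F z) :
    differential g (proj z) = fderiv ℂ F z := by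
  have hex : ∃ q : V × (V → V), proj q.1 = proj z ∧ IsHolLiftAt g q.2 q.1 := ⟨(z, F), rfl, h⟩
  rw [differential, dif_pos hex]
  exact fderiv_eq_of_lifts hex.choose_spec.1 hex.choose_spec.2 h

lemma isHolomorphic_id : IsHolomorphic id := fun _ =>
  ⟨id, analyticAt_id, Eventually.of_forall fun _ => rfl⟩

lemma IsHolomorphic.comp {g h : M → M} (hg : IsHolomorphic g) (hh : IsHolomorphic h) :
    IsHolomorphic (g ∘ h) := by
  intro z
  obtain ⟨H, hH, hH'⟩ := hh z
  obtain ⟨G, hG, hG'⟩ := hg (H z)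
  refine ⟨G ∘ H, hG.comp hH, ?_⟩
  filter_upwards [hH', hH.continuousAt.eventually hG'] with w h1 h2
  simp only [Function.comp_apply]
  rw [h2, h1]

lemma IsHolomorphic.iterate {g : M → M} (hg : IsHolomorphic g) (n : ℕ) :
    IsHolomorphic g^[n] := by
  induction n with
  | zero => exact isHolomorphic_id
  | succ n ih => exact ih.comp hg

/-- Biholomorphic automorphisms of `M`. -/
structure Aut extends M ≃ M where
  hol : IsHolomorphic toFun
  hol_symm : IsHolomorphic invFun

/-! ### Complex-valued differential forms on `M` -/

/-- Complex-valued alternating `k`-forms over `ℝ` on the tangent space `ℂ³`. -/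
abbrev Alt (k : ℕ) : Type := V [⋀^Fin k]→L[ℝ] ℂ

/-- Smooth complex-valued differential `k`-forms on `M`, as functions on `M` with values in the
alternating forms on the tangent space; smoothness is tested after pulling back to `ℂ³`. -/
def smoothForms (k : ℕ) : Submodule ℂ (M → Alt k) where
  carrier := {η | ContDiff ℝ ∞ fun z : V => η (proj z)}
  add_mem' {η θ} h₁ h₂ := by
    simp only [Set.mem_ofPred_eq] at h₁ h₂ ⊢
    exact h₁.add h₂
  zero_mem' := by
    simp only [Set.mem_ofPred_eq]
    exact contDiff_const
  smul_mem' c η h := by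
    simp only [Set.mem_ofPred_eq] at h ⊢
    exact h.const_smul c

/-- The complex vector space `Ω^k(M)` of smooth `k`-forms on `M`. -/
def Form (k : ℕ) : Type := smoothForms k

instance (k : ℕ) : AddCommGroup (Form k) := inferInstanceAs (AddCommGroup (smoothForms k))

instance (k : ℕ) : Module ℂ (Form k) := inferInstanceAs (Module ℂ (smoothForms k))

/-- The pullback to `ℂ³` of the form `η` on `M`. -/
def lift {k : ℕ} (η : M → Alt k) (z : V) : Alt k := η (proj z)

/-- The exterior derivative on `M`: the form whose pullback to `ℂ³` is the exterior derivative of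
the pullback (see `lift_extD`; the chosen point over `x` does not matter). -/
def extD {k : ℕ} (η : M → Alt k) (x : M) : Alt (k + 1) :=
  extDeriv (lift η) (Function.surjInv proj_surjective x)

lemma lift_extD {k : ℕ} (η : M → Alt k) : lift (extD η) = extDeriv (lift η) := by
  funext z
  set z' : V := Function.surjInv proj_surjective (proj z) with hz'
  have hp : proj z' = proj z := Function.surjInv_eq proj_surjective _
  have hper : (fun w : V => lift η (w + (z' - z))) = lift η := by
    funext w
    simp only [lift]
    rw [proj_add, proj_sub, hp, sub_self, add_zero]
  have hf : fderiv ℝ (lift η) z = fderiv ℝ (lift η) z' := by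
    conv_lhs => rw [← hper]
    rw [fderiv_comp_add_right, add_sub_cancel]
  change extDeriv (lift η) z' = extDeriv (lift η) z
  simp only [extDeriv, hf]

lemma Form.contDiff {k : ℕ} {η : M → Alt k} (h : η ∈ smoothForms k) : ContDiff ℝ ∞ (lift η) := h

lemma extDeriv_contDiff {k : ℕ} {η : V → Alt k} (h : ContDiff ℝ ∞ η) :
    ContDiff ℝ ∞ (extDeriv η) := by
  have h1 : ContDiff ℝ ∞ (fderiv ℝ η) := h.fderiv_right (by simp)
  exact (ContinuousAlternatingMap.alternatizeUncurryFinCLM ℝ V ℂ (n := k)).contDiff.comp h1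

lemma extDeriv_const_smul {k : ℕ} {η : V → Alt k} (h : ContDiff ℝ ∞ η) (c : ℂ) (z : V) :
    extDeriv (fun w => c • η w) z = c • extDeriv η z := by
  have hd : DifferentiableAt ℝ η z := h.contDiffAt.differentiableAt (by simp)
  have e : fderiv ℝ (fun w => c • η w) z = c • fderiv ℝ η z := fderiv_const_smul hd c
  ext v
  simp only [extDeriv, e, ContinuousAlternatingMap.alternatizeUncurryFin_apply,
    smul_apply, ContinuousAlternatingMap.smul_apply, Finset.smul_sum]
  exact Finset.sum_congr rfl fun i _ => smul_comm _ _ _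

lemma two_le_smooth : minSmoothness ℝ 2 ≤ (∞ : WithTop ℕ∞) := by
  rw [minSmoothness_of_isRCLikeNormedField]
  exact WithTop.coe_le_coe.2 le_top

lemma lift_injective {k : ℕ} {η θ : M → Alt k} (h : lift η = lift θ) : η = θ := by
  funext x
  obtain ⟨z, rfl⟩ := proj_surjective x
  exact congrFun h z

/-- The exterior derivative `d : Ω^k(M) → Ω^{k+1}(M)` as a linear map. -/
def d (k : ℕ) : Form k →ₗ[ℂ] Form (k + 1) where
  toFun η := ⟨extD η.1, by
    change ContDiff ℝ ∞ (lift (extD η.1))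
    rw [lift_extD]
    exact extDeriv_contDiff η.2⟩
  map_add' η θ := by
    apply Subtype.ext
    apply lift_injective
    rw [lift_extD]
    funext z
    have h1 : DifferentiableAt ℝ (lift η.1) z :=
      (Form.contDiff η.2).contDiffAt.differentiableAt (by simp)
    have h2 : DifferentiableAt ℝ (lift θ.1) z :=
      (Form.contDiff θ.2).contDiffAt.differentiableAt (by simp)
    have h3 : lift (extD η.1) z + lift (extD θ.1) z
        = extDeriv (lift η.1 + lift θ.1) z := by
      rw [lift_extD, lift_extD, extDeriv_add h1 h2]
    exact h3.symm
  map_smul' c η := by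
    apply Subtype.ext
    apply lift_injective
    rw [lift_extD]
    funext z
    have h3 : c • lift (extD η.1) z = extDeriv (fun w => c • lift η.1 w) z := by
      rw [lift_extD, extDeriv_const_smul (Form.contDiff η.2)]
    exact h3.symm

lemma d_d {k : ℕ} (η : Form k) : d (k + 1) (d k η) = 0 := by
  apply Subtype.ext
  apply lift_injective
  change lift (extD (extD η.1)) = 0
  rw [lift_extD, lift_extD]
  exact extDeriv_extDeriv (Form.contDiff η.2) two_le_smooth

/-! ### Pullback of forms by holomorphic maps -/

/-- Pullback of a form: `(g^* η)_x = η_{g x} ∘ (dg_x × ⋯ × dg_x)`. -/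
def pullbackFun {k : ℕ} (g : M → M) (η : M → Alt k) (x : M) : Alt k :=
  (η (g x)).compContinuousLinearMap ((differential g x).restrictScalars ℝ)

lemma lift_pullback_eventuallyEq {k : ℕ} {g : M → M} (η : M → Alt k) {F : V → V} {z : V}
    (h : IsHolLiftAt g F z) : lift (pullbackFun g η) =ᶠ[𝓝 z]
      fun w => (lift η (F w)).compContinuousLinearMap (fderiv ℝ F w) := by
  filter_upwards [h.1.eventually_analyticAt, h.2.eventually_nhds] with w h1 h2
  have hd : differential g (proj w) = fderiv ℂ F w := differential_eq ⟨h1, h2⟩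
  have hr : fderiv ℝ F w = (fderiv ℂ F w).restrictScalars ℝ :=
    h1.differentiableAt.fderiv_restrictScalars ℝ
  simp only [lift, pullbackFun]
  rw [hd, hr, h2.self_of_nhds]

lemma contDiffAt_compContinuousLinearMap {k : ℕ} {A : V → Alt k} {L : V → V →L[ℝ] V} {z : V}
    (hA : ContDiffAt ℝ ∞ A z) (hL : ContDiffAt ℝ ∞ L z) :
    ContDiffAt ℝ ∞ (fun w => (A w).compContinuousLinearMap (L w)) z := by
  have hsmooth : ContDiff ℝ ∞
      (fun q : Alt k × (V →L[ℝ] V) => q.1.compContinuousLinearMap q.2) := by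
    let CM := ContinuousMultilinearMap ℝ (fun _ : Fin k => V) ℂ
    let T : Alt k →L[ℝ] CM := ContinuousAlternatingMap.toContinuousMultilinearMapCLM ℝ
    have hT : Function.Injective T := ContinuousAlternatingMap.toContinuousMultilinearMap_injective
    have : FiniteDimensional ℝ CM := FiniteDimensional.of_injective
      (ContinuousMultilinearMap.toMultilinearMapLinear (R' := ℝ) (A := ℝ))
      ContinuousMultilinearMap.toMultilinearMap_injective
    obtain ⟨g, hg⟩ := T.toLinearMap.exists_leftInverse_of_injective (LinearMap.ker_eq_bot.2 hT)
    have hc : ContDiff ℝ ∞ (fun q : Alt k × (V →L[ℝ] V) =>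
        ContinuousMultilinearMap.compContinuousLinearMapContinuousMultilinear ℝ
          (fun _ : Fin k => V) (fun _ => V) ℂ (fun _ => q.2) (T q.1)) := by
      refine ContDiff.clm_apply ?_ (T.contDiff.comp contDiff_fst)
      exact (ContinuousMultilinearMap.contDiff _).comp (contDiff_pi.2 fun _ => contDiff_snd)
    have h2 := (LinearMap.toContinuousLinearMap g).contDiff.comp hc (n := ∞)
    convert h2 using 2 with q
    exact (LinearMap.congr_fun hg (q.1.compContinuousLinearMap q.2)).symm
  exact hsmooth.contDiffAt.comp z (hA.prodMk hL)

lemma pullbackFun_mem {k : ℕ} {g : M → M} (hg : IsHolomorphic g) {η : M → Alt k}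
    (hη : η ∈ smoothForms k) : pullbackFun g η ∈ smoothForms k := by
  change ContDiff ℝ ∞ (lift (pullbackFun g η))
  rw [contDiff_iff_contDiffAt]
  intro z
  obtain ⟨F, hF⟩ := hg z
  have hFs : ContDiffAt ℝ ∞ F z := hF.1.contDiffAt.restrict_scalars ℝ
  have h1 : ContDiffAt ℝ ∞ (fun w => lift η (F w)) z :=
    (Form.contDiff hη).contDiffAt.comp z hFs
  have h2 : ContDiffAt ℝ ∞ (fderiv ℝ F) z := hFs.fderiv_right (by simp)
  refine ContDiffAt.congr_of_eventuallyEq ?_ (lift_pullback_eventuallyEq η hF)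
  exact contDiffAt_compContinuousLinearMap h1 h2

lemma extD_pullbackFun {k : ℕ} {g : M → M} (hg : IsHolomorphic g) {η : M → Alt k}
    (hη : η ∈ smoothForms k) : extD (pullbackFun g η) = pullbackFun g (extD η) := by
  apply lift_injective
  rw [lift_extD]
  funext z
  obtain ⟨F, hF⟩ := hg z
  have hFs : ContDiffAt ℝ ∞ F z := hF.1.contDiffAt.restrict_scalars ℝ
  rw [(lift_pullback_eventuallyEq η hF).extDeriv_eq,
    (lift_pullback_eventuallyEq (extD η) hF).self_of_nhds, lift_extD]
  exact extDeriv_pullback ((Form.contDiff hη).contDiffAt.differentiableAt (by simp)) hFs two_le_smooth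

/-- The linear map `g^* : Ω^k(M) → Ω^k(M)`. -/
def pullback (k : ℕ) (g : M → M) (hg : IsHolomorphic g) : Form k →ₗ[ℂ] Form k where
  toFun η := ⟨pullbackFun g η.1, pullbackFun_mem hg η.2⟩
  map_add' _ _ := rfl
  map_smul' _ _ := rfl

lemma d_pullback {k : ℕ} {g : M → M} (hg : IsHolomorphic g) (η : Form k) :
    d k (pullback k g hg η) = pullback (k + 1) g hg (d k η) :=
  Subtype.ext (extD_pullbackFun hg η.2)

/-! ### De Rham cohomology and its `(p,q)`-parts -/

/-- Closed `k`-forms. -/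
abbrev Closed (k : ℕ) : Submodule ℂ (Form k) := LinearMap.ker (d k)

/-- Exact `k`-forms. -/
def Exact : (k : ℕ) → Submodule ℂ (Form k)
  | 0 => ⊥
  | k + 1 => LinearMap.range (d k)

/-- The de Rham cohomology `H^k(M, ℂ)`: closed forms modulo exact forms. -/
abbrev DeRham (k : ℕ) : Type := Closed k ⧸ (Exact k).submoduleOf (Closed k)

/-- An alternating form on `ℂ³` of degree `p + q` is of type `(p,q)`, i.e. a combination of the
`dz_I ∧ dz̄_J` with `|I| = p` and `|J| = q`, iff the scalars `u` act on it by `u^p ū^q`. -/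
def IsType (p q : ℕ) (η : Alt (p + q)) : Prop :=
  ∀ (u : ℂ) (v : Fin (p + q) → V),
    η (fun i => u • v i) = u ^ p * (starRingEnd ℂ u) ^ q * η v

/-- Closed forms of type `(p,q)`. -/
def ClosedType (p q : ℕ) : Submodule ℂ (Closed (p + q)) where
  carrier := {η | ∀ x, IsType p q (η.1.1 x)}
  add_mem' {η θ} h₁ h₂ x u v := by
    have e1 := h₁ x u v
    have e2 := h₂ x u v
    change η.1.1 x _ + θ.1.1 x _ = _ * (η.1.1 x _ + θ.1.1 x _)
    rw [e1, e2]; ring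
  zero_mem' x u v := (mul_zero _).symm
  smul_mem' c η h x u v := by
    have e1 := h x u v
    change c * η.1.1 x _ = _ * (c * η.1.1 x _)
    rw [e1]; ring

/-- `H^{p,q}(M)`: the classes in `H^{p+q}(M, ℂ)` represented by closed forms of type `(p,q)`. -/
def Hodge (p q : ℕ) : Submodule ℂ (DeRham (p + q)) :=
  (ClosedType p q).map (Submodule.mkQ _)

/-- `g^*` on closed forms. -/
def pullbackClosed (k : ℕ) (g : M → M) (hg : IsHolomorphic g) : Closed k →ₗ[ℂ] Closed k :=
  (pullback k g hg).restrict fun η hη => by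
    rw [LinearMap.mem_ker] at hη ⊢
    rw [d_pullback, hη, map_zero]

lemma pullback_mem_exact {k : ℕ} {g : M → M} (hg : IsHolomorphic g) {η : Form k}
    (h : η ∈ Exact k) : pullback k g hg η ∈ Exact k := by
  cases k with
  | zero =>
    have h0 : η = 0 := h
    rw [h0, map_zero]
    exact Submodule.zero_mem _
  | succ k =>
    obtain ⟨θ, rfl⟩ := h
    exact ⟨pullback k g hg θ, d_pullback hg θ⟩

/-- `g^*` on `H^k(M, ℂ)`. -/
def pullbackDeRham (k : ℕ) (g : M → M) (hg : IsHolomorphic g) : DeRham k →ₗ[ℂ] DeRham k :=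
  Submodule.mapQ _ _ (pullbackClosed k g hg) fun _ h => pullback_mem_exact hg h

lemma pullbackClosed_mem_type {p q : ℕ} {g : M → M} (hg : IsHolomorphic g)
    {η : Closed (p + q)} (h : η ∈ ClosedType p q) :
    pullbackClosed (p + q) g hg η ∈ ClosedType p q := by
  intro x u v
  change η.1.1 (g x) (fun i => differential g x (u • v i)) =
    _ * η.1.1 (g x) (fun i => differential g x (v i))
  rw [← h (g x) u]
  simp only [map_smul]

/-- `g^*` on `H^{p,q}(M)`. -/
def pullbackHodge (p q : ℕ) (g : M → M) (hg : IsHolomorphic g) :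
    Module.End ℂ (Hodge p q) :=
  (pullbackDeRham (p + q) g hg).restrict (p := Hodge p q) (q := Hodge p q) <| by
    rintro _ ⟨η, hη, rfl⟩
    exact ⟨pullbackClosed (p + q) g hg η, pullbackClosed_mem_type hg hη, rfl⟩

/-! ### Dynamical degrees -/

/-- `r_p(g)`: the spectral radius of `g^*` on `H^{p,p}(M)`. -/
def specRad (p : ℕ) (g : M → M) (hg : IsHolomorphic g) : ℝ≥0∞ :=
  spectralRadius ℂ (pullbackHodge p p g hg)

/-- `l` is the `p`-th dynamical degree of `f`, i.e. the limit of `r_p(f^n)^{1/n}` exists and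
equals `l`. -/
def IsDynamicalDegree (p : ℕ) (f : Aut) (l : ℝ) : Prop :=
  0 ≤ l ∧ Tendsto (fun n : ℕ => specRad p f.toFun^[n] (f.hol.iterate n) ^ (1 / (n : ℝ))) atTop
    (𝓝 (ENNReal.ofReal l))

/-! ### Automorphisms given by integer matrices -/

/-- The action of an integer matrix on `M`. -/
def matMap (P : Matrix (Fin 3) (Fin 3) ℤ) (x : M) : M := fun i => ∑ j, P i j • x j

lemma matMap_matMap (P Q : Matrix (Fin 3) (Fin 3) ℤ) (x : M) :
    matMap P (matMap Q x) = matMap (P * Q) x := by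
  funext i
  simp only [matMap, Matrix.mul_apply, Finset.smul_sum, smul_smul]
  rw [Finset.sum_comm]
  refine Finset.sum_congr rfl fun j _ => ?_
  exact (map_sum (zmultiplesHom E (x j)) _ _).symm

lemma matMap_one (x : M) : matMap 1 x = x := by
  funext i
  simp [matMap, Matrix.one_apply, ite_smul]

lemma isHolomorphic_matMap (P : Matrix (Fin 3) (Fin 3) ℤ) : IsHolomorphic (matMap P) := by
  intro z
  refine ⟨fun w i => ∑ j, P i j • w j, ?_, Eventually.of_forall fun w => ?_⟩
  · let L : V →ₗ[ℂ] V :=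
      { toFun := fun w i => ∑ j, P i j • w j
        map_add' := fun w w' => by
          funext i; simp [smul_add, Finset.sum_add_distrib]
        map_smul' := fun c w => by
          funext i; simp [Finset.mul_sum, mul_left_comm] }
    exact (LinearMap.toContinuousLinearMap L).analyticAt z
  · funext i
    simp only [proj, matMap]
    exact map_sum (QuotientAddGroup.mk' lattice) _ _

/-- The automorphism of `M` given by an element of `GL(3, ℤ)`. -/
def autOfGL (P : GL (Fin 3) ℤ) : Aut where
  toFun := matMap P.val
  invFun := matMap P.inv
  left_inv x := by rw [matMap_matMap, P.inv_val, matMap_one]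
  right_inv x := by rw [matMap_matMap, P.val_inv, matMap_one]
  hol := isHolomorphic_matMap _
  hol_symm := isHolomorphic_matMap _

/-- The matrix `P_a`, an element of `GL(3, ℤ)`. -/
def P (a : ℕ) : GL (Fin 3) ℤ where
  val := !![0, 1, 0; 0, 0, 1; -1, 3 * (a : ℤ) ^ 2, 0]
  inv := !![3 * (a : ℤ) ^ 2, 0, -1; 1, 0, 0; 0, 1, 0]
  val_inv := by
    ext i j
    fin_cases i <;> fin_cases j <;> simp [Matrix.mul_apply, Fin.sum_univ_three]
  inv_val := by
    ext i j
    fin_cases i <;> fin_cases j <;> simp [Matrix.mul_apply, Fin.sum_univ_three]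

/-- The automorphism `f_a` of `M` given by the matrix `P_a`. -/
def f (a : ℕ) : Aut := autOfGL (P a)

/-! ### Salem numbers -/

/-- A Salem number: a real algebraic integer `s > 1` such that `1/s` is a Galois conjugate of `s`
and all Galois conjugates other than `s` and `1/s` lie on the unit circle. -/
def IsSalem (s : ℝ) : Prop :=
  1 < s ∧ IsIntegral ℤ s ∧ aeval (s⁻¹) (minpoly ℚ s) = 0 ∧
    ∀ z : ℂ, aeval z (minpoly ℚ s) = 0 → z = (s : ℂ) ∨ z = ((s⁻¹ : ℝ) : ℂ) ∨ ‖z‖ = 1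

end EisensteinTorus

end

/-!
Averaging a closed form over the torus changes it by an exact form, so `H^k(M, ℂ)` is the space of
constant alternating forms and `g^*` acts on it through the linear map `A` lifting `g`. If `A` is
diagonalizable, an eigenvalue of `A^*` on `2p`-forms is at most a product of `2p` eigenvalue moduli
of `A` in which each occurs at most twice, because `‖c (A^n v₁, …)‖ ≤ ‖c‖ ∏ ‖A^n v_j‖`. The largest
such product is attained on `H^{p,p}` by the volume form of the `p` leading eigen-coordinates.
-/

universe u

section SegmentIntegral

variable {W F : Type u} [NormedAddCommGroup W] [NormedSpace ℝ W] [NormedAddCommGroup F]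
  [NormedSpace ℝ F]

/-- The integral of `G` over the segment from `z` to `z + e`, parametrized by `[0, 1]` and weighted
by `w`; with `w = 1` this is the average of `G` over the segment. -/
noncomputable def segmentIntegral (w : ℝ → ℝ) (e : W) (G : W → F) (z : W) : F :=
  ∫ t in (0 : ℝ)..1, w t • G (z + t • e)

lemma hasFDerivAt_segmentIntegral [FiniteDimensional ℝ W] {w : ℝ → ℝ} (hw : Continuous w) (e : W)
    {G : W → F} (hG : ContDiff ℝ 1 G) (z : W) :
    HasFDerivAt (segmentIntegral w e G) (segmentIntegral w e (fderiv ℝ G) z) z := by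
  have := hG.continuous
  have := hG.continuous_fderiv one_ne_zero
  have hjoint : Continuous fun q : W × ℝ => w q.2 • fderiv ℝ G (q.1 + q.2 • e) := by fun_prop
  have : ProperSpace W := FiniteDimensional.proper ℝ W
  obtain ⟨B, hB⟩ := ((isCompact_closedBall z 1).prod (isCompact_Icc (a := (0 : ℝ)) (b := 1))
    ).exists_bound_of_continuousOn hjoint.continuousOn
  refine intervalIntegral.hasFDerivAt_integral_of_dominated_of_fderiv_le
    (F := fun x t => w t • G (x + t • e)) (F' := fun x t => w t • fderiv ℝ G (x + t • e))
    (bound := fun _ => B) (Metric.closedBall_mem_nhds z one_pos)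
    (.of_forall fun x => ?_) ?_ ?_ (.of_forall fun t ht x hx => hB (x, t) ⟨hx, ?_⟩)
    intervalIntegrable_const (.of_forall fun t _ x _ => ?_)
  · exact Continuous.aestronglyMeasurable (by fun_prop)
  · exact Continuous.intervalIntegrable (by fun_prop) _ _
  · exact Continuous.aestronglyMeasurable (by fun_prop)
  · exact Set.Ioc_subset_Icc_self (Set.uIoc_of_le (zero_le_one' ℝ) ▸ ht)
  · exact ((hasFDerivAt_comp_add_right (t • e)).2
      (hG.differentiable one_ne_zero _).hasFDerivAt).const_smul (w t)

lemma contDiff_segmentIntegral [FiniteDimensional ℝ W] {w : ℝ → ℝ} (hw : Continuous w) (e : W)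
    {G : W → F} (hG : ContDiff ℝ ∞ G) : ContDiff ℝ ∞ (segmentIntegral w e G) := by
  rw [contDiff_infty]
  intro n
  induction n generalizing F with
  | zero =>
    rw [Nat.cast_zero, contDiff_zero, continuous_iff_continuousAt]
    exact fun z => (hasFDerivAt_segmentIntegral hw e (hG.of_le (by simp)) z).continuousAt
  | succ n ih =>
    rw [Nat.cast_succ, contDiff_succ_iff_hasFDerivAt]
    exact ⟨segmentIntegral w e (fderiv ℝ G), ih (hG.fderiv_right (by simp)),
      hasFDerivAt_segmentIntegral hw e (hG.of_le (by simp))⟩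

lemma map_segmentIntegral {F' : Type*} [NormedAddCommGroup F'] [NormedSpace ℝ F']
    [CompleteSpace F] [CompleteSpace F'] {w : ℝ → ℝ} (hw : Continuous w) (e : W) {G : W → F}
    (hG : Continuous G) (T : F →L[ℝ] F') (z : W) :
    T (segmentIntegral w e G z) = ∫ t in (0 : ℝ)..1, w t • T (G (z + t • e)) := by
  rw [segmentIntegral,
    ← T.intervalIntegral_comp_comm (Continuous.intervalIntegrable (by fun_prop) _ _)]
  simp only [map_smul]

lemma segmentIntegral_one_const [CompleteSpace F] (e : W) (c : F) :
    segmentIntegral 1 e (fun _ : W => c) = fun _ => c := by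
  funext z
  simp [segmentIntegral]

lemma segmentIntegral_one_sub_fderiv [CompleteSpace F] (e : W) {G : W → F} (hG : ContDiff ℝ 1 G)
    (z : W) : segmentIntegral (fun t => 1 - t) e (fun x => fderiv ℝ G x e) z =
      segmentIntegral 1 e G z - G z := by
  have := hG.continuous_fderiv one_ne_zero
  have hline : ∀ t : ℝ, HasDerivAt (fun t : ℝ => G (z + t • e)) (fderiv ℝ G (z + t • e) e) t :=
    fun t => (hG.differentiable one_ne_zero _).hasFDerivAt.comp_hasDerivAt t <| by
      simpa using ((hasDerivAt_id t).smul_const e).const_add z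
  have hweight : ∀ t : ℝ, HasDerivAt (fun t : ℝ => 1 - t) (-1) t :=
    fun t => (hasDerivAt_id t).const_sub 1
  have parts := intervalIntegral.integral_smul_deriv_eq_deriv_smul_of_hasDerivAt
    (a := 0) (b := 1) (by fun_prop) (by have := hG.continuous; fun_prop)
    (fun t _ => hweight t) (fun t _ => hline t) (by simp)
    (Continuous.intervalIntegrable (by fun_prop) _ _)
  simp only [segmentIntegral, parts, neg_smul, one_smul, Pi.one_apply,
    intervalIntegral.integral_neg]
  simp
  abel

lemma segmentIntegral_periodic {G : W → F} {v : W} (hv : Function.Periodic G v)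
    (w : ℝ → ℝ) (e : W) : Function.Periodic (segmentIntegral w e G) v := fun z => by
  simp only [segmentIntegral, add_right_comm z v, hv _]

lemma segmentIntegral_one_periodic_smul {e : W} {G : W → F} (he : Function.Periodic G e) (s : ℝ) :
    Function.Periodic (segmentIntegral 1 e G) (s • e) := fun z => by
  have hline : Function.Periodic (fun t : ℝ => G (z + t • e)) 1 := fun t => by
    simp only [add_smul, one_smul, ← add_assoc, he _]
  have hshift := intervalIntegral.integral_comp_add_left (a := 0) (b := 1)
    (fun t : ℝ => G (z + t • e)) s
  rw [add_zero, hline.intervalIntegral_add_eq s 0, zero_add] at hshift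
  simpa only [segmentIntegral, Pi.one_apply, one_smul, add_smul, add_assoc] using hshift

end SegmentIntegral

section IteratedAverage

variable {W F : Type u} [NormedAddCommGroup W] [NormedSpace ℝ W] [NormedAddCommGroup F]
  [NormedSpace ℝ F]

/-- The successive averages of `G` over segments in the directions listed in `l`. -/
noncomputable def iteratedAverage (l : List W) (G : W → F) : W → F :=
  l.foldr (segmentIntegral 1) G

lemma iteratedAverage_cons (e : W) (l : List W) (G : W → F) :
    iteratedAverage (e :: l) G = segmentIntegral 1 e (iteratedAverage l G) := rfl

lemma contDiff_iteratedAverage [FiniteDimensional ℝ W] (l : List W) {G : W → F}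
    (hG : ContDiff ℝ ∞ G) : ContDiff ℝ ∞ (iteratedAverage l G) := by
  induction l with
  | nil => exact hG
  | cons e l ih => exact contDiff_segmentIntegral continuous_one e ih

lemma iteratedAverage_const [CompleteSpace F] (l : List W) (c : F) :
    iteratedAverage l (fun _ => c) = fun _ => c := by
  induction l with
  | nil => rfl
  | cons e l ih => rw [iteratedAverage_cons, ih, segmentIntegral_one_const]

lemma iteratedAverage_periodic {G : W → F} {v : W} (hv : Function.Periodic G v) (l : List W) :
    Function.Periodic (iteratedAverage l G) v := by
  induction l with
  | nil => exact hv
  | cons e l ih => exact segmentIntegral_periodic ih 1 e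

lemma iteratedAverage_periodic_smul {l : List W} {G : W → F}
    (hG : ∀ e ∈ l, Function.Periodic G e) {e : W} (he : e ∈ l) (s : ℝ) :
    Function.Periodic (iteratedAverage l G) (s • e) := by
  induction l with
  | nil => exact absurd he List.not_mem_nil
  | cons e' l ih =>
    rw [List.forall_mem_cons] at hG
    rcases List.mem_cons.1 he with rfl | he
    · exact segmentIntegral_one_periodic_smul (iteratedAverage_periodic hG.1 l) s
    · exact segmentIntegral_periodic (ih hG.2 he) 1 e'

lemma iteratedAverage_eq_apply_zero {l : List W} (hl : Submodule.span ℝ {e | e ∈ l} = ⊤)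
    {G : W → F} (hG : ∀ e ∈ l, Function.Periodic G e) :
    iteratedAverage l G = fun _ => iteratedAverage l G 0 := by
  have hper : ∀ v : W, Function.Periodic (iteratedAverage l G) v := fun v => by
    have hv : v ∈ Submodule.span ℝ {e | e ∈ l} := hl ▸ Submodule.mem_top
    induction hv using Submodule.closure_induction with
    | zero => exact fun z => by rw [add_zero]
    | add v w _ _ hv hw => exact hv.add_period hw
    | smul_mem s e he => exact iteratedAverage_periodic_smul hG he s
  funext v
  simpa using hper v 0

end IteratedAverage

section ExteriorDerivative

variable {W F : Type u} [NormedAddCommGroup W] [NormedSpace ℝ W] [NormedAddCommGroup F]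
  [NormedSpace ℝ F] {k : ℕ}

lemma extDeriv_const (c : W [⋀^Fin k]→L[ℝ] F) : extDeriv (fun _ : W => c) = 0 := by
  funext z
  rw [extDeriv, fderiv_const_apply]
  exact map_zero (ContinuousAlternatingMap.alternatizeUncurryFinCLM ℝ W F (n := k))

lemma extDeriv_segmentIntegral [FiniteDimensional ℝ W] [CompleteSpace F] {w : ℝ → ℝ}
    (hw : Continuous w) (e : W) {η : W → W [⋀^Fin k]→L[ℝ] F} (hη : ContDiff ℝ ∞ η) :
    extDeriv (segmentIntegral w e η) = segmentIntegral w e (extDeriv η) := by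
  funext z
  have hη₁ : ContDiff ℝ 1 η := hη.of_le (by simp)
  rw [extDeriv, (hasFDerivAt_segmentIntegral hw e hη₁ z).fderiv]
  exact map_segmentIntegral hw e (hη₁.continuous_fderiv one_ne_zero)
    (ContinuousAlternatingMap.alternatizeUncurryFinCLM ℝ W F (n := k)) z

lemma eq_of_extDeriv_eq_zero {η : W → W [⋀^Fin 0]→L[ℝ] F} (hη : Differentiable ℝ η)
    (hclosed : extDeriv η = 0) (x y : W) : η x = η y := by
  refine is_const_of_fderiv_eq_zero hη (fun z => ?_) x y
  ext e v
  obtain rfl : v = Fin.tail fun _ => e := Subsingleton.elim _ _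
  have happly := extDeriv_apply (hη z) fun _ => e
  simpa [hclosed, fderiv_continuousAlternatingMap_apply_const_apply (hη z), eq_comm] using happly

/-- The contraction of an alternating form with the vector `e`, inserted in the first slot. -/
noncomputable def interiorProduct (e : W) :
    (W [⋀^Fin (k + 1)]→L[ℝ] F) →L[ℝ] W [⋀^Fin k]→L[ℝ] F :=
  (ContinuousLinearMap.apply ℝ _ e).comp
    (ContinuousAlternatingMap.curryLeftLI (𝕜 := ℝ)).toContinuousLinearMap

lemma interiorProduct_apply (e : W) (η : W [⋀^Fin (k + 1)]→L[ℝ] F) (v : Fin k → W) :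
    interiorProduct e η v = η (Fin.cons e v) := rfl

lemma extDeriv_interiorProduct (e : W) {η : W → W [⋀^Fin (k + 1)]→L[ℝ] F} {z : W}
    (hη : DifferentiableAt ℝ η z) :
    extDeriv (fun x => interiorProduct e (η x)) z =
      fderiv ℝ η z e - interiorProduct e (extDeriv η z) := by
  have hι : DifferentiableAt ℝ (fun x => interiorProduct e (η x)) z := by fun_prop
  ext v
  have hremove : ∀ i : Fin (k + 1),
      i.succ.removeNth (Fin.cons e v : Fin (k + 2) → W) = Fin.cons e (i.removeNth v) :=
    Fin.cons_comp_succ_succAbove e v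
  simp only [ContinuousAlternatingMap.sub_apply, interiorProduct_apply, extDeriv_apply hη,
    extDeriv_apply hι, Fin.sum_univ_succ (n := k + 1), hremove]
  simp [fderiv_continuousAlternatingMap_apply_const_apply hη, pow_succ, Fin.removeNth_zero]

lemma segmentIntegral_one_eq_add_extDeriv [FiniteDimensional ℝ W] [CompleteSpace F] (e : W)
    {η : W → W [⋀^Fin (k + 1)]→L[ℝ] F} (hη : ContDiff ℝ ∞ η) (hclosed : extDeriv η = 0) :
    segmentIntegral 1 e η =
      η + extDeriv (segmentIntegral (fun t => 1 - t) e fun x => interiorProduct e (η x)) := by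
  have hη₁ : ContDiff ℝ 1 η := hη.of_le (by simp)
  have hcartan : extDeriv (fun x => interiorProduct e (η x)) = fun x => fderiv ℝ η x e := by
    funext z
    rw [extDeriv_interiorProduct e (hη₁.differentiable one_ne_zero z), hclosed, Pi.zero_apply,
      map_zero, sub_zero]
  rw [extDeriv_segmentIntegral (by fun_prop) e (by fun_prop), hcartan]
  funext z
  rw [Pi.add_apply, segmentIntegral_one_sub_fderiv e hη₁, add_sub_cancel]

lemma extDeriv_iteratedAverage [FiniteDimensional ℝ W] [CompleteSpace F] (l : List W)
    {η : W → W [⋀^Fin k]→L[ℝ] F} (hη : ContDiff ℝ ∞ η) :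
    extDeriv (iteratedAverage l η) = iteratedAverage l (extDeriv η) := by
  induction l with
  | nil => rfl
  | cons e l ih =>
    rw [iteratedAverage_cons, iteratedAverage_cons,
      extDeriv_segmentIntegral continuous_one e (contDiff_iteratedAverage l hη), ih]

lemma exists_iteratedAverage_eq_add_extDeriv [FiniteDimensional ℝ W] [CompleteSpace F]
    (l : List W) {η : W → W [⋀^Fin (k + 1)]→L[ℝ] F} (hη : ContDiff ℝ ∞ η)
    (hclosed : extDeriv η = 0) :
    ∃ θ : W → W [⋀^Fin k]→L[ℝ] F, ContDiff ℝ ∞ θ ∧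
      (∀ v, Function.Periodic η v → Function.Periodic θ v) ∧
      iteratedAverage l η = η + extDeriv θ := by
  induction l with
  | nil => exact ⟨fun _ => 0, contDiff_const, fun _ _ _ => rfl, by
      rw [extDeriv_const, add_zero, iteratedAverage, List.foldr_nil]⟩
  | cons e l ih =>
    obtain ⟨θ, hθ, hθper, havg⟩ := ih
    have hsmooth : ContDiff ℝ ∞ (iteratedAverage l η) := contDiff_iteratedAverage l hη
    have hclosed' : extDeriv (iteratedAverage l η) = 0 := by
      rw [extDeriv_iteratedAverage l hη, hclosed]
      exact iteratedAverage_const l 0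
    set κ := segmentIntegral (fun t => 1 - t) e
      fun x => interiorProduct e (iteratedAverage l η x)
    have hκ : ContDiff ℝ ∞ κ :=
      contDiff_segmentIntegral (by fun_prop) e (by fun_prop)
    refine ⟨θ + κ, hθ.add hκ, fun v hv => (hθper v hv).add ?_, ?_⟩
    · exact segmentIntegral_periodic ((iteratedAverage_periodic hv l).comp _) _ e
    · funext z
      rw [iteratedAverage_cons, segmentIntegral_one_eq_add_extDeriv e hsmooth hclosed',
        Pi.add_apply, Pi.add_apply, extDeriv_add (hθ.differentiable (by simp) z)
        (hκ.differentiable (by simp) z), ← add_assoc, ← Pi.add_apply η, ← havg]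

end ExteriorDerivative

namespace EisensteinTorus

section Periods

/-- The generators `e_i` and `ω e_i` of the lattice of periods of the covering `ℂ³ → M`. -/
noncomputable def periods : List V :=
  (List.finRange 3).flatMap fun i => [Pi.single i 1, Pi.single i omega]

lemma mem_periods {e : V} :
    e ∈ periods ↔ ∃ i, e = Pi.single i 1 ∨ e = Pi.single i omega := by
  simp [periods]

lemma proj_single {x : ℂ} (hx : x ∈ lattice) (i : Fin 3) : proj (Pi.single i x) = 0 := by
  funext j
  refine (QuotientAddGroup.eq_zero_iff _).2 ?_
  rcases eq_or_ne j i with rfl | hji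
  · rwa [Pi.single_eq_same]
  · rw [Pi.single_eq_of_ne hji]
    exact lattice.zero_mem

lemma proj_eq_zero_of_mem_periods {e : V} (he : e ∈ periods) : proj e = 0 := by
  obtain ⟨i, rfl | rfl⟩ := mem_periods.1 he <;>
    exact proj_single (AddSubgroup.subset_closure (by simp)) i

lemma exists_eq_add_mul_omega (x : ℂ) : ∃ s t : ℝ, x = s + t * omega := by
  refine ⟨x.re + x.im / √3, 2 * x.im / √3, ?_⟩
  apply Complex.ext <;> simp [omega] <;> field_simp
  ring

lemma span_periods : Submodule.span ℝ {e | e ∈ periods} = ⊤ := by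
  refine eq_top_iff.2 fun v _ => ?_
  rw [← Finset.univ_sum_single v]
  refine Submodule.sum_mem _ fun i _ => ?_
  obtain ⟨s, t, hst⟩ := exists_eq_add_mul_omega (v i)
  have hsplit : (Pi.single i (v i) : V) =
      s • (Pi.single i 1 : V) + t • (Pi.single i omega : V) := by
    rw [← Pi.single_smul, ← Pi.single_smul, ← Pi.single_add, hst, Complex.real_smul,
      Complex.real_smul, mul_one]
  rw [hsplit]
  exact Submodule.add_mem _
    (Submodule.smul_mem _ s (Submodule.subset_span (mem_periods.2 ⟨i, .inl rfl⟩)))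
    (Submodule.smul_mem _ t (Submodule.subset_span (mem_periods.2 ⟨i, .inr rfl⟩)))

end Periods

section ConstantForms

variable {k : ℕ}

lemma lift_periodic (η : M → Alt k) {v : V} (hv : proj v = 0) :
    Function.Periodic (lift η) v := fun z => by
  simp only [lift, proj_add, hv, add_zero]

lemma exists_lift_eq {θ : V → Alt k} (hθ : ContDiff ℝ ∞ θ)
    (hper : ∀ v, proj v = 0 → Function.Periodic θ v) : ∃ ζ : Form k, lift ζ.1 = θ := by
  have hlift : lift (fun x => θ (Function.surjInv proj_surjective x)) = θ := by
    funext z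
    have hz : proj (Function.surjInv proj_surjective (proj z) - z) = 0 := by
      rw [proj_sub, Function.surjInv_eq proj_surjective, sub_self]
    simpa [lift] using hper _ hz z
  exact ⟨⟨_, (congrArg (ContDiff ℝ ∞) hlift).mpr hθ⟩, hlift⟩

lemma lift_d (η : Form k) : lift (d k η).1 = extDeriv (lift η.1) := lift_extD _

lemma extDeriv_lift_closed (η : Closed k) : extDeriv (lift η.1.1) = 0 := by
  rw [← lift_d, LinearMap.mem_ker.1 η.2]
  rfl

/-- The form on `M` with constant coefficients `c`, as a closed form. -/
noncomputable def constForm (k : ℕ) : Alt k →ₗ[ℂ] Closed k where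
  toFun c := ⟨⟨fun _ => c, (contDiff_const : ContDiff ℝ ∞ fun _ : V => c)⟩,
    Subtype.ext (lift_injective ((lift_extD _).trans (extDeriv_const c)))⟩
  map_add' _ _ := rfl
  map_smul' _ _ := rfl

/-- The cohomology class of the form with constant coefficients `c`. -/
noncomputable def constClass (k : ℕ) : Alt k →ₗ[ℂ] DeRham k := (Submodule.mkQ _).comp (constForm k)

lemma iteratedAverage_periods_lift (η : M → Alt k) :
    iteratedAverage periods (lift η) = fun _ => iteratedAverage periods (lift η) 0 :=
  iteratedAverage_eq_apply_zero span_periods fun _ he =>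
    lift_periodic η (proj_eq_zero_of_mem_periods he)

lemma constClass_zero_bijective : Function.Bijective (constClass 0) := by
  constructor
  · refine (injective_iff_map_eq_zero _).2 fun c hc => ?_
    have hzero : (constForm 0 c).1 = 0 := (Submodule.Quotient.mk_eq_zero _).1 hc
    exact congrFun (congrArg Subtype.val hzero) 0
  · intro x
    obtain ⟨η, rfl⟩ := Submodule.mkQ_surjective _ x
    refine ⟨lift η.1.1 0, congrArg _ (Subtype.ext (Subtype.ext (lift_injective ?_)))⟩
    funext z
    exact eq_of_extDeriv_eq_zero ((Form.contDiff η.1.2).differentiable (by simp))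
      (extDeriv_lift_closed η) 0 z

lemma constClass_succ_injective (k : ℕ) : Function.Injective (constClass (k + 1)) := by
  refine (injective_iff_map_eq_zero _).2 fun c hc => ?_
  obtain ⟨θ, hθ⟩ := (Submodule.Quotient.mk_eq_zero _).1 hc
  have hlift : extDeriv (lift θ.1) = fun _ => c := by
    rw [← lift_d, hθ]
    rfl
  have havg := extDeriv_iteratedAverage periods (Form.contDiff θ.2)
  rw [hlift, iteratedAverage_const, iteratedAverage_periods_lift, extDeriv_const] at havg
  exact (congrFun havg 0).symm

lemma constClass_succ_surjective (k : ℕ) : Function.Surjective (constClass (k + 1)) := by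
  intro x
  obtain ⟨η, rfl⟩ := Submodule.mkQ_surjective _ x
  obtain ⟨θ, hθ, hθper, havg⟩ := exists_iteratedAverage_eq_add_extDeriv periods
    (Form.contDiff η.1.2) (extDeriv_lift_closed η)
  obtain ⟨ζ, hζ⟩ := exists_lift_eq hθ fun v hv => hθper v (lift_periodic η.1.1 hv)
  refine ⟨iteratedAverage periods (lift η.1.1) 0,
    (Submodule.Quotient.eq _).2 ⟨ζ, Subtype.ext (lift_injective ?_)⟩⟩
  rw [lift_d, hζ]
  funext z
  have hz := congrFun havg z
  rw [iteratedAverage_periods_lift, Pi.add_apply] at hz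
  exact (sub_eq_of_eq_add' hz).symm

theorem constClass_bijective : ∀ k, Function.Bijective (constClass k)
  | 0 => constClass_zero_bijective
  | k + 1 => ⟨constClass_succ_injective k, constClass_succ_surjective k⟩

instance finiteDimensional_alt (k : ℕ) : FiniteDimensional ℂ (Alt k) := by
  have hreal : FiniteDimensional ℝ (Alt k) :=
    FiniteDimensional.of_injective
      (AlternatingMap.toMultilinearMapLM.comp
        (ContinuousAlternatingMap.toAlternatingMapLinear (R := ℝ) (A := ℝ)))
      (AlternatingMap.coe_multilinearMap_injective.comp
        ContinuousAlternatingMap.toAlternatingMap_injective)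
  exact FiniteDimensional.right ℝ ℂ (Alt k)

instance finiteDimensional_deRham (k : ℕ) : FiniteDimensional ℂ (DeRham k) :=
  Module.Finite.of_surjective (constClass k) (constClass_bijective k).2

end ConstantForms

section IntegerMatrices

/-- The linear lift to `ℂ³` of `matMap Q`, as a ring homomorphism in `Q`. -/
noncomputable def matCLM : Matrix (Fin 3) (Fin 3) ℤ →+* (V →L[ℂ] V) :=
  (Matrix.toLinAlgEquiv'.trans (Module.End.toContinuousLinearMap V)).toRingEquiv.toRingHom.comp
    (Int.castRingHom ℂ).mapMatrix

lemma matCLM_apply (Q : Matrix (Fin 3) (Fin 3) ℤ) (v : V) :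
    matCLM Q v = (Q.map (Int.castRingHom ℂ)).mulVec v := rfl

lemma proj_matCLM (Q : Matrix (Fin 3) (Fin 3) ℤ) (z : V) :
    proj (matCLM Q z) = matMap Q (proj z) := by
  funext i
  have hi : matCLM Q z i = ∑ j, Q i j • z j := by
    simp [matCLM_apply, Matrix.mulVec, dotProduct]
  rw [proj, hi]
  exact map_sum (QuotientAddGroup.mk' lattice) _ _

lemma differential_matMap (Q : Matrix (Fin 3) (Fin 3) ℤ) (x : M) :
    differential (matMap Q) x = matCLM Q := by
  obtain ⟨z, rfl⟩ := proj_surjective x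
  rw [differential_eq (F := matCLM Q) ⟨(matCLM Q).analyticAt z, .of_forall (proj_matCLM Q)⟩]
  exact (matCLM Q).fderiv

lemma iterate_matMap (Q : Matrix (Fin 3) (Fin 3) ℤ) (n : ℕ) :
    (matMap Q)^[n] = matMap (Q ^ n) := by
  induction n with
  | zero => exact funext fun x => by rw [pow_zero, matMap_one, Function.iterate_zero_apply]
  | succ n ih =>
    exact funext fun x => by rw [Function.iterate_succ_apply, ih, matMap_matMap, pow_succ]

lemma pullbackDeRham_constClass {k : ℕ} (Q : Matrix (Fin 3) (Fin 3) ℤ) (c : Alt k) :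
    pullbackDeRham k (matMap Q) (isHolomorphic_matMap Q) (constClass k c) =
      constClass k (c.compContinuousLinearMap ((matCLM Q).restrictScalars ℝ)) := by
  refine congrArg (Submodule.mkQ _) (Subtype.ext (Subtype.ext (funext fun x => ?_)))
  change c.compContinuousLinearMap ((differential (matMap Q) x).restrictScalars ℝ) = _
  rw [differential_matMap]
  rfl

end IntegerMatrices

end EisensteinTorus

lemma le_of_forall_pow_le_mul_pow {x y C : ℝ} (hy : 0 ≤ y) (h : ∀ n : ℕ, x ^ n ≤ C * y ^ n) :
    x ≤ y := by
  by_contra! hyx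
  rcases hy.eq_or_lt with rfl | hy
  · exact absurd (by simpa using h 1) hyx.not_ge
  · obtain ⟨n, hn⟩ := pow_unbounded_of_one_lt C ((one_lt_div hy).2 hyx)
    rw [div_pow, lt_div_iff₀ (pow_pos hy n)] at hn
    exact absurd (h n) hn.not_ge

section GreedyProduct

lemma prod_le_prod_of_card_eq {κ : Type*} {S T : Finset κ} (hcard : S.card = T.card)
    {a : κ → ℝ} (ha : ∀ x, 0 ≤ a x) (hT : ∀ x ∈ T, ∀ y ∉ T, a y ≤ a x) :
    ∏ x ∈ S, a x ≤ ∏ x ∈ T, a x := by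
  classical
  have hdiff : (S \ T).card = (T \ S).card := Finset.card_sdiff_comm hcard
  have hswap : ∏ x ∈ S \ T, a x ≤ ∏ x ∈ T \ S, a x := by
    rw [← Finset.prod_coe_sort (S \ T), ← Finset.prod_coe_sort (T \ S),
      ← (Finset.equivOfCardEq hdiff).prod_comp]
    refine Finset.prod_le_prod (fun x _ => ha x) fun x _ => hT _ ?_ _ ?_
    · exact (Finset.mem_sdiff.1 (Finset.equivOfCardEq hdiff x).2).1
    · exact (Finset.mem_sdiff.1 x.2).2
  rw [← Finset.prod_inter_mul_prod_sdiff S T, ← Finset.prod_inter_mul_prod_sdiff T S,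
    Finset.inter_comm T S]
  exact mul_le_mul_of_nonneg_left hswap (Finset.prod_nonneg fun x _ => ha x)

lemma prod_comp_injective_le_prod_sq {n p : ℕ} (hp : p ≤ n) {a : Fin n → ℝ} (ha : ∀ i, 0 ≤ a i)
    (hanti : Antitone a) {s : Fin (p + p) → Fin 2 × Fin n} (hs : Function.Injective s) :
    ∏ j, a (s j).2 ≤ ∏ i : Fin p, a (i.castLE hp) ^ 2 := by
  set T : Finset (Fin 2 × Fin n) := Finset.univ ×ˢ Finset.univ.map (Fin.castLEEmb hp)
  have hmem : ∀ q, q ∈ T ↔ q.2.val < p := fun q => by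
    simp only [T, Finset.mem_product, Finset.mem_univ, true_and, Finset.mem_map,
      Fin.castLEEmb_apply]
    exact ⟨fun ⟨i, hi⟩ => hi ▸ i.2, fun hq => ⟨⟨q.2, hq⟩, rfl⟩⟩
  calc ∏ j, a (s j).2 = ∏ q ∈ Finset.univ.map ⟨s, hs⟩, a q.2 := by
        rw [Finset.prod_map, Function.Embedding.coeFn_mk]
    _ ≤ ∏ q ∈ T, a q.2 :=
        prod_le_prod_of_card_eq (by simp [T, two_mul]) (fun q => ha q.2) fun x hx y hy =>
          hanti (Fin.le_def.2 (((hmem x).1 hx).le.trans (not_lt.1 (mt (hmem y).2 hy))))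
    _ = ∏ i : Fin p, a (i.castLE hp) ^ 2 := by
        simp only [T, Finset.prod_product, Finset.prod_map, Fin.castLEEmb_apply,
          Finset.prod_const, Finset.card_univ, Fintype.card_fin, Finset.prod_pow]

end GreedyProduct

section Eigenforms

variable {W : Type*} [NormedAddCommGroup W] [NormedSpace ℂ W] {T : W →L[ℂ] W}

lemma pow_apply_eq_smul {v : W} {ν : ℂ} (hv : T v = ν • v) (n : ℕ) : (T ^ n) v = ν ^ n • v := by
  induction n with
  | zero => simp
  | succ n ih =>
    rw [pow_succ, mul_apply_eq_comp, hv, map_smul, ih, smul_smul, pow_succ']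

variable [NormedSpace ℝ W] [IsScalarTower ℝ ℂ W]

lemma apply_pow_eq_of_eigenform {k : ℕ} {c : W [⋀^Fin k]→L[ℝ] ℂ} {μ : ℂ}
    (hμ : c.compContinuousLinearMap (T.restrictScalars ℝ) = μ • c) (n : ℕ) (v : Fin k → W) :
    c (fun j => (T ^ n) (v j)) = μ ^ n * c v := by
  induction n generalizing v with
  | zero => simp
  | succ n ih =>
    have hstep : c (fun j => T (v j)) = μ * c v := DFunLike.congr_fun hμ v
    simp only [pow_succ, mul_apply_eq_comp, ih fun j => T (v j), hstep, mul_assoc]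

lemma exists_injective_norm_eigenvalue_le {ι : Type*} {b : Module.Basis ι ℂ W} {ev : ι → ℂ}
    (hb : ∀ i, T (b i) = ev i • b i) {k : ℕ} {c : W [⋀^Fin k]→L[ℝ] ℂ} (hc : c ≠ 0) {μ : ℂ}
    (hμ : c.compContinuousLinearMap (T.restrictScalars ℝ) = μ • c) :
    ∃ s : Fin k → Fin 2 × ι, Function.Injective s ∧ ‖μ‖ ≤ ∏ j, ‖ev (s j).2‖ := by
  let B : Module.Basis (Fin 2 × ι) ℝ W := Complex.basisOneI.smulTower b
  have hB : ∀ (n : ℕ) q, (T ^ n) (B q) = ev q.2 ^ n • B q := fun n q => by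
    rw [Module.Basis.smulTower_apply, map_smul, pow_apply_eq_smul (hb _), smul_comm]
  obtain ⟨s, hs, hcs⟩ : ∃ s : Fin k → Fin 2 × ι, Function.Injective s ∧ c (B ∘ s) ≠ 0 := by
    by_contra! hvanish
    exact hc (ContinuousAlternatingMap.toAlternatingMap_injective
      (Module.Basis.ext_alternating B hvanish))
  refine ⟨s, hs, le_of_forall_pow_le_mul_pow (C := ‖c‖ * (∏ j, ‖B (s j)‖) / ‖c (B ∘ s)‖)
    (Finset.prod_nonneg fun _ _ => norm_nonneg _) fun n => ?_⟩
  rw [div_mul_eq_mul_div, le_div_iff₀ (norm_pos_iff.2 hcs)]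
  calc ‖μ‖ ^ n * ‖c (B ∘ s)‖ = ‖c fun j => (T ^ n) (B (s j))‖ := by
        rw [apply_pow_eq_of_eigenform hμ n, norm_mul, norm_pow]
        rfl
    _ ≤ ‖c‖ * ∏ j, ‖(T ^ n) (B (s j))‖ := c.le_opNorm _
    _ = ‖c‖ * (∏ j, ‖B (s j)‖) * (∏ j, ‖ev (s j).2‖) ^ n := by
        simp only [hB, norm_smul, norm_pow, Finset.prod_mul_distrib, Finset.prod_pow]
        ring

end Eigenforms

section CoordinateVolume

variable {p : ℕ}

lemma finrank_real_fin_complex (p : ℕ) : Module.finrank ℝ (Fin p → ℂ) = p + p := by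
  rw [finrank_real_of_complex, Module.finrank_fin_fun, two_mul]

/-- The real volume form of `ℂ^p`, normalized by some real basis. -/
noncomputable def complexVolume (p : ℕ) : (Fin p → ℂ) [⋀^Fin (p + p)]→L[ℝ] ℝ where
  __ := (Module.finBasisOfFinrankEq ℝ (Fin p → ℂ) (finrank_real_fin_complex p)).det
  cont := by
    let B := Module.finBasisOfFinrankEq ℝ (Fin p → ℂ) (finrank_real_fin_complex p)
    refine Continuous.matrix_det (continuous_matrix fun i j => ?_)
    exact (B.coord i).continuous_of_finiteDimensional.comp (continuous_apply j)

lemma complexVolume_ne_zero : complexVolume p ≠ 0 := fun h =>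
  one_ne_zero <| ((Module.finBasisOfFinrankEq ℝ (Fin p → ℂ)
    (finrank_real_fin_complex p)).det_self).symm.trans (DFunLike.congr_fun h _)

lemma complexVolume_mul (d : Fin p → ℂ) (v : Fin (p + p) → Fin p → ℂ) :
    complexVolume p (fun j => d * v j) = (∏ i, ‖d i‖ ^ 2) * complexVolume p v := by
  have hdet : LinearMap.det ((Matrix.toLin' (Matrix.diagonal d)).restrictScalars ℝ) =
      ∏ i, ‖d i‖ ^ 2 := by
    rw [LinearMap.det_restrictScalars, LinearMap.det_toLin', Matrix.det_diagonal,
      Algebra.norm_complex_apply, map_prod]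
    simp only [Complex.normSq_eq_norm_sq]
  have hdiag (w : Fin p → ℂ) :
      (Matrix.toLin' (Matrix.diagonal d)).restrictScalars ℝ w = d * w := by
    funext i
    simp [Matrix.mulVec_diagonal]
  rw [← hdet, ← funext fun j => hdiag (v j)]
  exact Module.Basis.det_comp _ _ v

variable {W : Type*} [NormedAddCommGroup W] [NormedSpace ℂ W] [FiniteDimensional ℂ W] {n : ℕ}

/-- The first `p` coordinates with respect to the basis `b`. -/
noncomputable def leadingCoords (b : Module.Basis (Fin n) ℂ W) (hp : p ≤ n) :
    W →L[ℂ] (Fin p → ℂ) :=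
  LinearMap.toContinuousLinearMap (LinearMap.pi fun i => b.coord (i.castLE hp))

lemma leadingCoords_surjective {b : Module.Basis (Fin n) ℂ W} {hp : p ≤ n} :
    Function.Surjective (leadingCoords b hp) := fun y => by
  refine ⟨b.equivFun.symm (Function.extend (Fin.castLE hp) y 0), funext fun i => ?_⟩
  change b.equivFun (b.equivFun.symm _) (i.castLE hp) = y i
  rw [LinearEquiv.apply_symm_apply, (Fin.castLE_injective hp).extend_apply]

variable [NormedSpace ℝ W] [IsScalarTower ℝ ℂ W]

/-- The `(p, p)`-form on `W` obtained by pulling back the volume form of `ℂ^p` along the first `p`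
coordinates. -/
noncomputable def leadingVolume (b : Module.Basis (Fin n) ℂ W) (hp : p ≤ n) :
    W [⋀^Fin (p + p)]→L[ℝ] ℂ :=
  Complex.ofRealCLM.compContinuousAlternatingMap
    ((complexVolume p).compContinuousLinearMap ((leadingCoords b hp).restrictScalars ℝ))

variable {b : Module.Basis (Fin n) ℂ W} {hp : p ≤ n}

lemma leadingVolume_ne_zero : leadingVolume b hp ≠ 0 := fun h => complexVolume_ne_zero <| by
  ext v
  choose w hw using fun j => leadingCoords_surjective (b := b) (hp := hp) (v j)
  rw [← funext hw]
  exact Complex.ofReal_eq_zero.1 (DFunLike.congr_fun h w)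

lemma leadingVolume_apply_of_leadingCoords_eq_mul {S : W → W} {d : Fin p → ℂ}
    (hS : ∀ v, leadingCoords b hp (S v) = d * leadingCoords b hp v) (v : Fin (p + p) → W) :
    leadingVolume b hp (fun j => S (v j)) = ((∏ i, ‖d i‖ ^ 2 : ℝ) : ℂ) * leadingVolume b hp v := by
  change ((complexVolume p fun j => leadingCoords b hp (S (v j)) : ℝ) : ℂ) = _
  simp only [hS, complexVolume_mul, Complex.ofReal_mul]
  rfl

lemma leadingVolume_smul (u : ℂ) (v : Fin (p + p) → W) :
    leadingVolume b hp (fun j => u • v j) = (u * starRingEnd ℂ u) ^ p * leadingVolume b hp v := by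
  rw [leadingVolume_apply_of_leadingCoords_eq_mul (S := (u • ·)) (d := fun _ => u)
    fun w => map_smul _ u w]
  simp [Complex.mul_conj, Complex.normSq_eq_norm_sq]

lemma leadingVolume_comp {T : W →L[ℂ] W} {ev : Fin n → ℂ} (hb : ∀ i, T (b i) = ev i • b i) :
    (leadingVolume b hp).compContinuousLinearMap (T.restrictScalars ℝ) =
      ((∏ i : Fin p, ‖ev (i.castLE hp)‖ ^ 2 : ℝ) : ℂ) • leadingVolume b hp := by
  have hcoord (i : Fin n) (v : W) : b.coord i (T v) = ev i * b.coord i v := by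
    have h : b.coord i ∘ₗ T.toLinearMap = ev i • b.coord i := b.ext fun j => by
      rcases eq_or_ne j i with rfl | hji
      · simp [hb]
      · simp [hb, hji]
    exact LinearMap.congr_fun h v
  ext v
  exact leadingVolume_apply_of_leadingCoords_eq_mul (S := T) (d := fun i => ev (i.castLE hp))
    (fun w => funext fun i => hcoord _ w) v

end CoordinateVolume

namespace EisensteinTorus

section Spectrum

variable {Q : Matrix (Fin 3) (Fin 3) ℤ} {p q : ℕ}

lemma exists_eigenform_of_mem_spectrum {μ : ℂ}
    (hμ : μ ∈ spectrum ℂ (pullbackHodge p q (matMap Q) (isHolomorphic_matMap Q))) :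
    ∃ c : Alt (p + q), c ≠ 0 ∧
      c.compContinuousLinearMap ((matCLM Q).restrictScalars ℝ) = μ • c := by
  obtain ⟨x, hx, hx0⟩ := (Module.End.hasEigenvalue_iff_mem_spectrum.2 hμ).exists_hasEigenvector
  rw [Module.End.mem_eigenspace_iff] at hx
  obtain ⟨c, hc⟩ := (constClass_bijective (p + q)).2 x.1
  refine ⟨c, ?_, (constClass_bijective (p + q)).1 ?_⟩
  · rintro rfl
    exact hx0 (Subtype.ext (by rw [← hc, map_zero]; rfl))
  · rw [← pullbackDeRham_constClass, map_smul, hc]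
    exact congrArg Subtype.val hx

lemma mem_spectrum_of_eigenform {c : Alt (p + q)} (hc : c ≠ 0) (htype : IsType p q c) {μ : ℂ}
    (hμ : c.compContinuousLinearMap ((matCLM Q).restrictScalars ℝ) = μ • c) :
    μ ∈ spectrum ℂ (pullbackHodge p q (matMap Q) (isHolomorphic_matMap Q)) := by
  have hmem : constClass (p + q) c ∈ Hodge p q := ⟨constForm (p + q) c, fun _ => htype, rfl⟩
  refine Module.End.HasEigenvalue.mem_spectrum (Module.End.hasEigenvalue_of_hasEigenvector
    (x := ⟨_, hmem⟩) ⟨?_, fun h0 => hc ?_⟩)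
  · rw [Module.End.mem_eigenspace_iff]
    refine Subtype.ext ((pullbackDeRham_constClass Q c).trans ?_)
    rw [hμ, map_smul]
    rfl
  · exact (constClass_bijective (p + q)).1 ((congrArg Subtype.val h0).trans (map_zero _).symm)

variable {b : Module.Basis (Fin 3) ℂ V} {ev : Fin 3 → ℂ}

lemma isType_leadingVolume (hp : p ≤ 3) : IsType p p (leadingVolume b hp) := fun u v => by
  rw [leadingVolume_smul, mul_pow]

theorem specRad_matMap (hb : ∀ i, matCLM Q (b i) = ev i • b i) (hev : Antitone fun i => ‖ev i‖)
    (hp : p ≤ 3) :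
    specRad p (matMap Q) (isHolomorphic_matMap Q) =
      ENNReal.ofReal (∏ i : Fin p, ‖ev (i.castLE hp)‖ ^ 2) := by
  apply le_antisymm
  · refine iSup₂_le fun μ hμ => ?_
    obtain ⟨c, hc, hμc⟩ := exists_eigenform_of_mem_spectrum hμ
    obtain ⟨s, hs, hμs⟩ := exists_injective_norm_eigenvalue_le hb hc hμc
    rw [← enorm_eq_nnnorm, ← ofReal_norm]
    exact ENNReal.ofReal_le_ofReal
      (hμs.trans (prod_comp_injective_le_prod_sq hp (fun _ => norm_nonneg _) hev hs))
  · have hmem := mem_spectrum_of_eigenform leadingVolume_ne_zero (isType_leadingVolume hp)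
      (leadingVolume_comp hb)
    refine le_of_eq_of_le ?_ (le_iSup₂ (f := fun (μ : ℂ) (_ : μ ∈ spectrum ℂ _) =>
      (‖μ‖₊ : ℝ≥0∞)) _ hmem)
    rw [← enorm_eq_nnnorm, ← ofReal_norm, Complex.norm_of_nonneg (by positivity)]

lemma isDynamicalDegree_of_specRad_eq {g : Aut} {r : ℝ} (hr : 0 ≤ r)
    (h : ∀ n : ℕ, specRad p g.toFun^[n] (g.hol.iterate n) = ENNReal.ofReal (r ^ n)) :
    IsDynamicalDegree p g r := by
  refine ⟨hr, tendsto_const_nhds.congr' ?_⟩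
  filter_upwards [eventually_ne_atTop 0] with n hn
  rw [h, ENNReal.ofReal_pow hr, one_div, ENNReal.pow_rpow_inv_natCast hn]

theorem isDynamicalDegree_autOfGL {A : GL (Fin 3) ℤ} (hb : ∀ i, matCLM A.val (b i) = ev i • b i)
    (hev : Antitone fun i => ‖ev i‖) (hp : p ≤ 3) :
    IsDynamicalDegree p (autOfGL A) (∏ i : Fin p, ‖ev (i.castLE hp)‖ ^ 2) := by
  refine isDynamicalDegree_of_specRad_eq (by positivity) fun n => ?_
  have hiter : (autOfGL A).toFun^[n] = matMap (A.val ^ n) := iterate_matMap A.val n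
  have hpow (i : Fin 3) : matCLM (A.val ^ n) (b i) = ev i ^ n • b i := by
    rw [map_pow, pow_apply_eq_smul (hb i)]
  have hanti : Antitone fun i => ‖ev i ^ n‖ := fun i j hij => by
    simpa only [norm_pow] using pow_le_pow_left₀ (norm_nonneg _) (hev hij) n
  simp only [hiter, specRad_matMap hpow hanti hp, norm_pow, ← Finset.prod_pow, pow_right_comm]

end Spectrum

end EisensteinTorus

section Cubic

lemma X_pow_three_sub_mul_X_add_one_eq_prod {K : Type*} [Field K] {t x y z : K}
    (hx : x ^ 3 - t * x + 1 = 0) (hy : y ^ 3 - t * y + 1 = 0) (hz : z ^ 3 - t * z + 1 = 0)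
    (hxy : x ≠ y) (hyz : y ≠ z) (hxz : x ≠ z) :
    (X ^ 3 - C t * X + 1 : K[X]) = (X - C x) * (X - C y) * (X - C z) := by
  have hdivxy : x ^ 2 + x * y + y ^ 2 = t :=
    mul_left_cancel₀ (sub_ne_zero.2 hxy) (by linear_combination hx - hy)
  have hdivyz : y ^ 2 + y * z + z ^ 2 = t :=
    mul_left_cancel₀ (sub_ne_zero.2 hyz) (by linear_combination hy - hz)
  have hsum : z = -x - y :=
    mul_left_cancel₀ (sub_ne_zero.2 hxz) (by linear_combination hdivxy - hdivyz)
  have hconst : x * y * z = -1 := by linear_combination hx - x * hdivxy + x * y * hsum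
  have hC : C x * C y * C z = -1 := by rw [← C_mul, ← C_mul, hconst, C_neg, C_1]
  subst hsum hdivxy
  simp only [C_add, C_sub, C_neg, C_mul, C_pow] at hC ⊢
  linear_combination hC

lemma exists_roots_of_two_lt {t : ℝ} (ht : 2 < t) : ∃ x y z : ℝ,
    x ^ 3 - t * x + 1 = 0 ∧ y ^ 3 - t * y + 1 = 0 ∧ z ^ 3 - t * z + 1 = 0 ∧
      |z| < 1 ∧ 1 < |y| ∧ |y| < |x| := by
  have hcont : Continuous fun x : ℝ => x ^ 3 - t * x + 1 := by fun_prop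
  have hsq : √t ^ 2 = t := Real.sq_sqrt (by linarith)
  have hcube : √t ^ 3 = t * √t := by rw [pow_succ, hsq]
  have hone : 1 < √t := Real.lt_sqrt_of_sq_lt (by linarith)
  obtain ⟨z, hz, hz0⟩ := intermediate_value_Ioo' zero_le_one hcont.continuousOn
    (show (0 : ℝ) ∈ Set.Ioo _ _ from ⟨by linarith, by norm_num⟩)
  obtain ⟨y, hy, hy0⟩ := intermediate_value_Ioo hone.le hcont.continuousOn
    (show (0 : ℝ) ∈ Set.Ioo _ _ from ⟨by linarith, by linarith⟩)
  obtain ⟨x, hx, hx0⟩ := intermediate_value_Ioo (show -(√t + 1) ≤ -√t by linarith)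
    hcont.continuousOn (show (0 : ℝ) ∈ Set.Ioo _ _ from ⟨by nlinarith, by linarith⟩)
  refine ⟨x, y, z, hx0, hy0, hz0, abs_lt.2 ⟨by linarith [hz.1], hz.2⟩,
    hy.1.trans_le (le_abs_self y), ?_⟩
  rw [abs_of_pos (by linarith [hy.1]), abs_of_neg (by linarith [hx.2])]
  linarith [hy.2, hx.2]

lemma exists_basis_pow {K : Type*} [Field K] {n : ℕ} {x : Fin n → K} (hx : Function.Injective x) :
    ∃ b : Module.Basis (Fin n) K (Fin n → K), ∀ i, b i = fun j : Fin n => x i ^ (j : ℕ) := by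
  have hli : LinearIndependent K (Matrix.vandermonde x).row :=
    Matrix.linearIndependent_rows_of_det_ne_zero (Matrix.det_vandermonde_ne_zero_iff.2 hx)
  refine ⟨.mk hli (hli.span_eq_top_of_card_eq_finrank' (by simp)).ge, fun i => ?_⟩
  rw [Module.Basis.mk_apply]
  rfl

end Cubic

namespace EisensteinTorus

lemma charpoly_P (a : ℕ) : (P a).val.charpoly = X ^ 3 - C (3 * (a : ℤ) ^ 2) * X + 1 := by
  rw [Matrix.charpoly, Matrix.det_fin_three]
  simp [P]
  ring

lemma matCLM_P_pow {a : ℕ} {x : ℂ} (hx : x ^ 3 - 3 * (a : ℂ) ^ 2 * x + 1 = 0) :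
    matCLM (P a).val (fun j => x ^ (j : ℕ)) = x • fun j : Fin 3 => x ^ (j : ℕ) := by
  rw [matCLM_apply]
  funext i
  fin_cases i <;> simp [P, Matrix.mulVec, dotProduct, Fin.sum_univ_three]
  · ring
  · linear_combination -hx

theorem isDynamicalDegree_f {a : ℕ} {x : Fin 3 → ℝ}
    (hroot : ∀ i, x i ^ 3 - 3 * (a : ℝ) ^ 2 * x i + 1 = 0) (hanti : StrictAnti fun i => |x i|)
    {p : ℕ} (hp : p ≤ 3) : IsDynamicalDegree p (f a) (∏ i : Fin p, x (i.castLE hp) ^ 2) := by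
  have hinj : Function.Injective x := .of_comp (f := (|·|)) hanti.injective
  obtain ⟨b, hb⟩ := exists_basis_pow (Complex.ofReal_injective.comp hinj)
  have heigen (i : Fin 3) : matCLM (P a).val (b i) = (x i : ℂ) • b i := by
    rw [hb i]
    exact matCLM_P_pow (x := x i) (by exact_mod_cast hroot i)
  have hnorm : Antitone fun i => ‖(x i : ℂ)‖ := by simpa using hanti.antitone
  simpa [f] using isDynamicalDegree_autOfGL heigen hnorm hp

-- The conjugates of `α²` are roots of `X (X - t)² - 1`, which at `x²` is `-F(x) F(-x)` for
-- `F = X³ - t X + 1`; so `α⁻²` being a conjugate makes `α⁻¹` or `-α⁻¹` a root of `F`.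
lemma not_isSalem_sq {t : ℚ} {α β γ : ℝ}
    (hfac : (X ^ 3 - C (t : ℝ) * X + 1 : ℝ[X]) = (X - C α) * (X - C β) * (X - C γ))
    (hα : 1 < |α|) (hγ : 1 < |γ|) : ¬ IsSalem (α ^ 2) := by
  rintro ⟨-, -, hinv, -⟩
  have heval (x : ℝ) : x ^ 3 - t * x + 1 = (x - α) * (x - β) * (x - γ) := by
    simpa using congrArg (eval x) hfac
  have hdvd : minpoly ℚ (α ^ 2) ∣ X * (X - C t) ^ 2 - 1 := minpoly.dvd _ _ <| by
    simp only [map_sub, map_mul, map_pow, aeval_X, aeval_C, map_one, eq_ratCast]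
    linear_combination (α ^ 3 - t * α - 1) * heval α
  have hroot : (α⁻¹ - α) * (α⁻¹ - β) * (α⁻¹ - γ) * ((-α⁻¹ - α) * (-α⁻¹ - β) * (-α⁻¹ - γ)) = 0 := by
    have hq := aeval_eq_zero_of_dvd_aeval_eq_zero hdvd hinv
    simp only [map_sub, map_mul, map_pow, aeval_X, aeval_C, map_one, eq_ratCast] at hq
    rw [← heval, ← heval]
    linear_combination -hq
  have habs : |α|⁻¹ = |α| ∨ |α|⁻¹ = |β| ∨ |α|⁻¹ = |γ| := by
    simp only [← abs_inv, abs_eq_abs]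
    grind
  have hprod : |α| * |β| * |γ| = 1 := by
    rw [← abs_mul, ← abs_mul, ← abs_neg, ← abs_one]
    congr 1
    linear_combination -heval 0
  have hlt : |α|⁻¹ < 1 := inv_lt_one_of_one_lt₀ hα
  rcases habs with h | h | h
  · linarith
  · rw [← h, mul_inv_cancel₀ (by positivity), one_mul] at hprod
    exact hγ.ne' hprod
  · linarith

end EisensteinTorus

theorem lemma4p3 (a : ℕ) (ha : 1 ≤ a) :
    (EisensteinTorus.P a).val.charpoly = X ^ 3 - C (3 * (a : ℤ) ^ 2) * X + 1 ∧
    ∃ α β γ : ℝ,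
      (EisensteinTorus.P a).val.charpoly.map (Int.castRingHom ℝ) =
        (X - C α) * (X - C β) * (X - C γ) ∧
      |β| < 1 ∧ 1 < |γ| ∧ |γ| < |α| ∧
      EisensteinTorus.IsDynamicalDegree 1 (EisensteinTorus.f a) (α ^ 2) ∧
      EisensteinTorus.IsDynamicalDegree 2 (EisensteinTorus.f a) (α ^ 2 * γ ^ 2) ∧
      1 < α ^ 2 ∧ α ^ 2 < α ^ 2 * γ ^ 2 ∧
      ¬ EisensteinTorus.IsSalem (α ^ 2) := by
  open EisensteinTorus in
  refine ⟨charpoly_P a, ?_⟩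
  have ha' : (1 : ℝ) ≤ (a : ℝ) ^ 2 := one_le_pow₀ (by exact_mod_cast ha)
  obtain ⟨α, γ, β, hα, hγ, hβ, hβ1, hγ1, hγα⟩ :=
    exists_roots_of_two_lt (t := 3 * (a : ℝ) ^ 2) (by linarith)
  have hfac := X_pow_three_sub_mul_X_add_one_eq_prod hα hβ hγ
    (by rintro rfl; linarith) (by rintro rfl; linarith) (by rintro rfl; exact lt_irrefl _ hγα)
  have hdeg {p : ℕ} (hp : p ≤ 3) : IsDynamicalDegree p (f a) _ :=
    isDynamicalDegree_f (x := ![α, γ, β]) (by simp [Fin.forall_fin_succ, hα, hβ, hγ])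
      (Fin.strictAnti_iff_succ_lt.2 (by simp [Fin.forall_fin_succ, hγα, hβ1.trans hγ1])) hp
  have hα2 : 1 < α ^ 2 := (one_lt_sq_iff_one_lt_abs α).2 (hγ1.trans hγα)
  have hγ2 : 1 < γ ^ 2 := (one_lt_sq_iff_one_lt_abs γ).2 hγ1
  have hsalem : ¬ IsSalem (α ^ 2) :=
    not_isSalem_sq (t := 3 * (a : ℚ) ^ 2) (by simpa using hfac) (hγ1.trans hγα) hγ1
  refine ⟨α, β, γ, by simp [charpoly_P, ← hfac, C_ofNat], hβ1, hγ1, hγα, ?_, ?_, hα2,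
    lt_mul_of_one_lt_right (by positivity) hγ2, hsalem⟩
  · simpa using hdeg (show 1 ≤ 3 by simp)
  · simpa [Fin.prod_univ_two] using hdeg (show 2 ≤ 3 by simp)
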